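/- Let $(X,d)$ be a metric space and let $\mathfrak B$ be a bornology on $X$ (a nonempty family of subsets of $X$ that covers $X$ and is closed under taking subsets and finite unions) with a closed base, i.e. every member of $\mathfrak B$ is contained in a member of $\mathfrak B$ that is closed in $X$. For $B\subseteq X$ and $\delta>0$ put $B^\delta=\bigcup_{x\in B}\{y\in X: d(x,y)<\delta\}$. Let $\mathcal O_{\mathfrak B^s}$ be the class of open $\mathfrak B^s$-covers of $X$: families $\mathcal U$ of open sets covering $X$ with $X\notin\mathcal U$ such that for every $B\in\mathfrak B$ there are $U\in\mathcal U$ and $\delta>0$ with $B^\delta\subseteq U$. Let $\mathcal O^{gp}_{\mathfrak B^s}$ be the class of those $\mathcal U\in\mathcal O_{\mathfrak B^s}$ that are $\mathfrak B^s$-groupable: $\mathcal U=\bigcup_{m\in\mathbb N}\mathcal U_m$ with finite, pairwise disjoint $\mathcal U_m$ such that for every $B\in\mathfrak B$ there is $m_0$ such that for each $m\ge m_0$ there are $U\in\mathcal U_m$ and $\delta>0$ with $B^{\delta}\subseteq U$. Then the following are equivalent. (1) $X$ has the $\mathfrak B^s$-Gerlits–Nagy property, i.e. the selection principle $S_1(\mathcal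 O_{\mathfrak B^s},\mathcal O^{gp}_{\mathfrak B^s})$ holds: for every sequence $(\mathcal U_m)_{m\in\mathbb N}$ in $\mathcal O_{\mathfrak B^s}$ there are $U_m\in\mathcal U_m$ ($m\in\mathbb N$) with $\{U_m:m\in\mathbb N\}\in\mathcal O^{gp}_{\mathfrak B^s}$. (2) For all integers $n,k\ge 1$ the ordinary partition relation $\mathcal O_{\mathfrak B^s}\to(\mathcal O^{gp}_{\mathfrak B^s})^n_k$ holds: for every $\mathcal U\in\mathcal O_{\mathfrak B^s}$ and every colouring $f:[\mathcal U]^n\to\{1,\dots,k\}$ of the $n$-element subsets of $\mathcal U$ there are $i\in\{1,\dots,k\}$ and $\mathcal V\subseteq\mathcal U$ with $\mathcal V\in\mathcal O^{gp}_{\mathfrak B^s}$ such that $f(s)=i$ for every $n$-element subset $s$ of $\mathcal V$. -/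

import Mathlib

/-- The selection principle `S₁(𝒜, ℬ)`: from every sequence of members of `𝒜` one can select one
element of each so that the set of selected elements belongs to `ℬ`. -/
def SelectionS1 {α : Type*} (𝒜 ℬ : Set (Set α)) : Prop :=
  ∀ A : ℕ → Set α, (∀ m, A m ∈ 𝒜) →
    ∃ b : ℕ → α, (∀ m, b m ∈ A m) ∧ Set.range b ∈ ℬ

/-- `[S]ⁿ`, the set of all subsets of `S` with exactly `n` elements. -/
def nSubsets {α : Type*} (S : Set α) (n : ℕ) : Set (Finset α) :=
  {s | (s : Set α) ⊆ S ∧ s.card = n}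

/-- The ordinary partition relation `𝒜 → (ℬ)ⁿ_k`: for every `S ∈ 𝒜` and every colouring of `[S]ⁿ`
with `k` colours, some `T ⊆ S` with `T ∈ ℬ` has all its `n`-element subsets of one colour. -/
def PartitionRel {α : Type*} (𝒜 ℬ : Set (Set α)) (n k : ℕ) : Prop :=
  ∀ S ∈ 𝒜, ∀ f : nSubsets S n → Fin k,
    ∃ i : Fin k, ∃ T ∈ ℬ, T ⊆ S ∧ ∀ s : nSubsets S n, ((s : Finset α) : Set α) ⊆ T → f s = i

namespace Bornological

variable {X : Type*} [MetricSpace X]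

/-- `B ∈ 𝔅`: the set `B` is a member of the bornology `𝔅` (which is unrelated to the bornology of
metrically bounded sets that the metric space carries). -/
def Mem (𝔅 : Bornology X) (B : Set X) : Prop := @Bornology.IsBounded X 𝔅 B

/-- `𝔅` has a base (a cofinal subfamily) that consists of closed sets. -/
def HasClosedBase (𝔅 : Bornology X) : Prop :=
  ∃ 𝔅₀ : Set (Set X), (∀ B ∈ 𝔅₀, Mem 𝔅 B ∧ IsClosed B) ∧ ∀ B, Mem 𝔅 B → ∃ B₀ ∈ 𝔅₀, B ⊆ B₀

/-- `𝒰` is a cover of `X` by open sets. -/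
def IsOpenCover (𝒰 : Set (Set X)) : Prop := (∀ U ∈ 𝒰, IsOpen U) ∧ ⋃₀ 𝒰 = Set.univ

/-- The class of open strong-`𝔅`-covers: open covers `𝒰` with `X ∉ 𝒰` such that for every `B ∈ 𝔅`
some `U ∈ 𝒰` contains an enlargement `B^δ = ⋃ x ∈ B, ball x δ`, `δ > 0`. -/
def strongCovers (𝔅 : Bornology X) : Set (Set (Set X)) :=
  {𝒰 | IsOpenCover 𝒰 ∧ Set.univ ∉ 𝒰 ∧
    ∀ B, Mem 𝔅 B → ∃ U ∈ 𝒰, ∃ δ : ℝ, 0 < δ ∧ Metric.thickening δ B ⊆ U}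

/-- `𝒰` is `𝔅ˢ`-groupable: it is the union of a sequence of pairwise disjoint finite families `𝒱 m`
such that for every `B ∈ 𝔅`, for all large `m`, some `U ∈ 𝒱 m` contains an enlargement of `B`. -/
def IsGroupable (𝔅 : Bornology X) (𝒰 : Set (Set X)) : Prop :=
  ∃ 𝒱 : ℕ → Set (Set X), (∀ m, (𝒱 m).Finite) ∧ Pairwise (fun l m => Disjoint (𝒱 l) (𝒱 m)) ∧
    𝒰 = ⋃ m, 𝒱 m ∧
    ∀ B, Mem 𝔅 B → ∃ m₀ : ℕ, ∀ m, m₀ ≤ m →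
      ∃ U ∈ 𝒱 m, ∃ δ : ℝ, 0 < δ ∧ Metric.thickening δ B ⊆ U

/-- The class of `𝔅ˢ`-groupable open strong-`𝔅`-covers. -/
def groupableCovers (𝔅 : Bornology X) : Set (Set (Set X)) :=
  {𝒰 | 𝒰 ∈ strongCovers 𝔅 ∧ IsGroupable 𝔅 𝒰}

/-- The `𝔅ˢ`-Gerlits–Nagy property of `X`. -/
def GerlitsNagy (𝔅 : Bornology X) : Prop :=
  SelectionS1 (strongCovers 𝔅) (groupableCovers 𝔅)

end Bornological

/-!
Write `𝒪` for the strong covers and `𝒪ᵍᵖ` for the groupable ones. Strong covers form a coideal: if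
a union of two families is a strong cover then one of the two is (`union_mem_strongCovers`), and a
finite family never is (`not_mem_strongCovers_of_finite`). A countable family of open proper subsets
that contains a groupable cover is groupable (`IsGroupable.of_subset`), since the extra sets can be
added to the groups one at a time. Hence, as soon as every strong cover contains a groupable one,
groupability comes for free, and both implications become statements about `𝒪` alone.

*From selection to partition.* `S₁(𝒪, 𝒪)` makes the coideal selective. A selection from a decreasing
sequence of subcovers is almost contained in each of them (`exists_pseudoIntersection`). To thin out
a countable cover to one that meets each fibre of a finite-to-one map at most once
(`exists_injOn`), select from the covers by intersections of `n + 1` sets from distinct fibres; one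
of these sets lies in a fibre not used by the other selected sets. Together these give diagonal
intersections (`exists_diagonal`), from which Ramsey's theorem for sets in the coideal follows by the
usual induction on the exponent (`exists_homogeneous`).

*From partition to selection.* Given strong covers `A n`, enumerate a countable subcover `V n` of
`A 0`, and colour pairs of sets of the form `V n ∩ W`, `W ∈ A n`, according to whether they have the
same index `n`. A homogeneous cover cannot have a constant index because `V n ≠ X`, so it has at
most one set for each index and yields a selection (`selectionS1_of_partitionRel`).
-/

/-! ### Ramsey's theorem for selective coideals on `ℕ` -/

/-- Hall's theorem in the case of a sequence of finite sets, the `n`-th of which has more than `n`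
elements. -/
theorem exists_injective_mem_of_lt_card {α : Type*} [DecidableEq α] (T : ℕ → Finset α)
    (hT : ∀ n, n < (T n).card) : ∃ t : ℕ → α, Function.Injective t ∧ ∀ n, t n ∈ T n := by
  refine (Finset.all_card_le_biUnion_card_iff_exists_injective T).1 fun I => ?_
  rcases I.eq_empty_or_nonempty with rfl | hI
  · simp
  calc I.card ≤ (Finset.range (I.max' hI + 1)).card :=
        Finset.card_le_card fun i hi =>
          Finset.mem_range.2 (Nat.lt_succ_of_le (I.le_max' i hi))
    _ = I.max' hI + 1 := Finset.card_range _
    _ ≤ (T (I.max' hI)).card := hT _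
    _ ≤ (I.biUnion T).card :=
        Finset.card_le_card (Finset.subset_biUnion_of_mem T (I.max'_mem hI))

theorem exists_of_biUnion {α ι : Type*} {P : Set α → Prop} (hempty : ¬ P ∅)
    (hunion : ∀ A B, P (A ∪ B) → P A ∨ P B) (s : Finset ι) (A : ι → Set α)
    (h : P (⋃ i ∈ s, A i)) : ∃ i ∈ s, P (A i) := by
  classical
  induction s using Finset.induction_on with
  | empty => exact absurd (by simpa using h) hempty
  | insert a s _ ih =>
    rw [Finset.set_biUnion_insert] at h
    rcases hunion _ _ h with h | h
    · exact ⟨a, Finset.mem_insert_self _ _, h⟩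
    · obtain ⟨i, hi, hPi⟩ := ih h
      exact ⟨i, Finset.mem_insert_of_mem hi, hPi⟩

/-- Ramsey's theorem inside a coideal `P` of subsets of `ℕ` that is closed under diagonal
intersections of decreasing sequences. -/
theorem exists_homogeneous {P : Set ℕ → Prop} (hempty : ¬ P ∅)
    (hunion : ∀ A B, P (A ∪ B) → P A ∨ P B)
    (hdiag : ∀ A : ℕ → Set ℕ, Antitone A → (∀ i, P (A i)) →
      ∃ D, P D ∧ D ⊆ A 0 ∧ ∀ i ∈ D, ∀ j ∈ D, i < j → j ∈ A i)
    {κ : Type*} [Fintype κ] (n : ℕ) (f : Finset ℕ → κ) (A : Set ℕ) (hA : P A) :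
    ∃ D ⊆ A, P D ∧ ∃ c, ∀ s : Finset ℕ, (s : Set ℕ) ⊆ D → s.card = n → f s = c := by
  induction n generalizing f A with
  | zero => exact ⟨A, subset_rfl, hA, f ∅, fun s _ hs => by rw [Finset.card_eq_zero.1 hs]⟩
  | succ n ih =>
    -- Step `i` shrinks the current set so that the colour of `insert i s` no longer depends on `s`.
    choose D hDA hD c hc using fun (i : ℕ) (A : {A // P A}) => ih (fun s => f (insert i s)) A A.2
    -- `E i` is the set before step `i`.
    let E : ℕ → {A // P A} := fun i =>
      Nat.rec ⟨A, hA⟩ (fun i (F : {A // P A}) => ⟨D i F, hD i F⟩) i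
    have hE : Antitone fun i => (E (i + 1)).1 :=
      antitone_nat_of_succ_le fun i => hDA (i + 1) (E (i + 1))
    obtain ⟨G, hG, hG0, hGE⟩ := hdiag _ hE fun i => (E (i + 1)).2
    -- On the diagonal intersection the colour of a set depends on its least element only.
    have hmin : ∀ (i : ℕ) (s : Finset ℕ), i ∈ G → (s : Set ℕ) ⊆ G → (∀ j ∈ s, i < j) →
        s.card = n → f (insert i s) = c i (E i) := fun i s hi hs hlt hcard =>
      hc i (E i) s (fun j hj => hGE i hi j (hs hj) (hlt j hj)) hcard
    obtain ⟨e, -, he⟩ := exists_of_biUnion hempty hunion Finset.univ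
      (fun e => {i ∈ G | c i (E i) = e}) (by
        have : (⋃ e ∈ (Finset.univ : Finset κ), {i ∈ G | c i (E i) = e}) = G := by
          ext i; simp
        rwa [this])
    refine ⟨_, fun i hi => hDA 0 (E 0) (hG0 hi.1), he, e, fun s hs hcard => ?_⟩
    have hne : s.Nonempty := Finset.card_pos.1 (by omega)
    have hmem := s.min'_mem hne
    rw [← Finset.insert_erase hmem, hmin _ _ (hs hmem).1
      (fun j hj => (hs (Finset.mem_of_mem_erase hj)).1)
      (fun j hj => Finset.min'_lt_of_mem_erase_min' s hne hj)
      (by rw [Finset.card_erase_of_mem hmem, hcard]; rfl)]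
    exact (hs hmem).2

/-- For every `g` there is a monotone finite-to-one map `h` such that `i` and `j` are separated by
`g` as soon as the values of `h` differ by at least two. -/
theorem exists_separating_map (g : ℕ → ℕ) : ∃ h : ℕ → ℕ, Monotone h ∧
    (∀ k, (h ⁻¹' {k}).Finite) ∧ ∀ i j, h i + 2 ≤ h j → g i ≤ j := by
  -- The fibres of `h` are the intervals between consecutive values of `a`.
  obtain ⟨a, ha0, ha⟩ : ∃ a : ℕ → ℕ, a 0 = 0 ∧
      ∀ k, a (k + 1) = a k + 1 + ∑ i ∈ Finset.range (a k + 1), g i :=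
    ⟨fun k => Nat.rec (motive := fun _ => ℕ) 0
      (fun _ x => x + 1 + ∑ i ∈ Finset.range (x + 1), g i) k, rfl, fun _ => rfl⟩
  have hmono : StrictMono a := strictMono_nat_of_lt_succ fun k => by rw [ha]; omega
  let h : ℕ → ℕ := fun i => Nat.findGreatest (fun k => a k ≤ i) i
  have h1 : ∀ i, a (h i) ≤ i := fun i =>
    Nat.findGreatest_spec (P := fun k => a k ≤ i) (Nat.zero_le i) (ha0.trans_le (Nat.zero_le i))
  have h2 : ∀ i k, a k ≤ i → k ≤ h i := fun i k hk =>
    Nat.le_findGreatest (P := fun k => a k ≤ i) (hmono.le_apply.trans hk) hk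
  have h3 : ∀ i, i < a (h i + 1) := fun i => by
    by_contra! hi
    have := h2 i _ hi
    omega
  refine ⟨h, fun i j hij => h2 j _ ((h1 i).trans hij), fun k => ?_, fun i j hij => ?_⟩
  · refine (Set.finite_lt_nat (a (k + 1))).subset fun i hi => ?_
    have hi : h i = k := hi
    simpa [hi] using h3 i
  · have hg : g i ≤ ∑ l ∈ Finset.range (a (h i + 1) + 1), g l :=
      Finset.single_le_sum (f := g) (fun _ _ => Nat.zero_le _)
        (Finset.mem_range.2 ((h3 i).trans (Nat.lt_succ_self _)))
    calc g i ≤ a (h i + 2) := by rw [ha]; omega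
      _ ≤ a (h j) := hmono.monotone hij
      _ ≤ j := h1 j

namespace Bornological

/-! ### The coideal of strong covers -/

variable {X : Type*} {𝔅 : Bornology X}

theorem Mem.union {B C : Set X} (hB : Mem 𝔅 B) (hC : Mem 𝔅 C) : Mem 𝔅 (B ∪ C) :=
  (@Bornology.isBounded_union X 𝔅 B C).2 ⟨hB, hC⟩

theorem mem_of_finite {B : Set X} (hB : B.Finite) : Mem 𝔅 B := @Set.Finite.isBounded X 𝔅 B hB

variable [MetricSpace X]

/-- `U` contains an enlargement `B^δ`, `δ > 0`. -/
def StronglyContains (U B : Set X) : Prop := ∃ δ : ℝ, 0 < δ ∧ Metric.thickening δ B ⊆ U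

theorem StronglyContains.mono {U V B C : Set X} (h : StronglyContains U B) (hUV : U ⊆ V)
    (hCB : C ⊆ B) : StronglyContains V C := by
  obtain ⟨δ, hδ, hB⟩ := h
  exact ⟨δ, hδ, (Metric.thickening_subset_of_subset δ hCB).trans (hB.trans hUV)⟩

theorem StronglyContains.subset {U B : Set X} (h : StronglyContains U B) : B ⊆ U := by
  obtain ⟨δ, hδ, hB⟩ := h
  exact (Metric.self_subset_thickening hδ B).trans hB

theorem StronglyContains.inter {U V B : Set X} (hU : StronglyContains U B)
    (hV : StronglyContains V B) : StronglyContains (U ∩ V) B := by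
  obtain ⟨δ, hδ, hB⟩ := hU
  obtain ⟨ε, hε, hB'⟩ := hV
  exact ⟨min δ ε, lt_min hδ hε, Set.subset_inter
    ((Metric.thickening_mono (min_le_left _ _) B).trans hB)
    ((Metric.thickening_mono (min_le_right _ _) B).trans hB')⟩

theorem StronglyContains.biInter {ι : Type*} {U : ι → Set X} {B : Set X} (s : Finset ι)
    (h : ∀ i ∈ s, StronglyContains (U i) B) : StronglyContains (⋂ i ∈ s, U i) B := by
  classical
  induction s using Finset.induction_on with
  | empty => exact ⟨1, one_pos, by simp⟩
  | insert a s _ ih =>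
    rw [Finset.set_biInter_insert]
    exact (h a (Finset.mem_insert_self _ _)).inter
      (ih fun i hi => h i (Finset.mem_insert_of_mem hi))

/-- The covering condition is redundant, as the bornology contains all singletons. -/
theorem mem_strongCovers_iff {𝒰 : Set (Set X)} : 𝒰 ∈ strongCovers 𝔅 ↔
    (∀ U ∈ 𝒰, IsOpen U) ∧ Set.univ ∉ 𝒰 ∧ ∀ B, Mem 𝔅 B → ∃ U ∈ 𝒰, StronglyContains U B := by
  refine ⟨fun h => ⟨h.1.1, h.2⟩, fun h => ⟨⟨h.1, Set.eq_univ_of_forall fun x => ?_⟩, h.2⟩⟩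
  obtain ⟨U, hU, hx⟩ := h.2.2 {x} (mem_of_finite (Set.finite_singleton x))
  exact ⟨U, hU, hx.subset rfl⟩

/-- A strong cover stays one when its members are replaced by larger open proper subsets of the
space and further such sets are added. -/
theorem strongCovers_of_refines {𝒰 𝒱 : Set (Set X)} (h𝒰 : 𝒰 ∈ strongCovers 𝔅)
    (hopen : ∀ V ∈ 𝒱, IsOpen V) (huniv : Set.univ ∉ 𝒱) (h : ∀ U ∈ 𝒰, ∃ V ∈ 𝒱, U ⊆ V) :
    𝒱 ∈ strongCovers 𝔅 := by
  refine mem_strongCovers_iff.2 ⟨hopen, huniv, fun B hB => ?_⟩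
  obtain ⟨U, hU, hUB⟩ := (mem_strongCovers_iff.1 h𝒰).2.2 B hB
  obtain ⟨V, hV, hUV⟩ := h U hU
  exact ⟨V, hV, hUB.mono hUV subset_rfl⟩

theorem nonempty_of_mem_strongCovers {𝒰 : Set (Set X)} (h : 𝒰 ∈ strongCovers 𝔅) :
    𝒰.Nonempty := by
  obtain ⟨U, hU, -⟩ := h.2.2 ∅ (mem_of_finite Set.finite_empty)
  exact ⟨U, hU⟩

theorem union_mem_strongCovers {𝒰 𝒱 : Set (Set X)} (h : 𝒰 ∪ 𝒱 ∈ strongCovers 𝔅) :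
    𝒰 ∈ strongCovers 𝔅 ∨ 𝒱 ∈ strongCovers 𝔅 := by
  obtain ⟨hopen, huniv, hB⟩ := mem_strongCovers_iff.1 h
  by_contra! hcon
  obtain ⟨B, hB𝔅, hBU⟩ : ∃ B, Mem 𝔅 B ∧ ∀ U ∈ 𝒰, ¬ StronglyContains U B := by
    by_contra! h'
    exact hcon.1 (mem_strongCovers_iff.2
      ⟨fun U hU => hopen U (Or.inl hU), fun hU => huniv (Or.inl hU), h'⟩)
  obtain ⟨C, hC𝔅, hCU⟩ : ∃ B, Mem 𝔅 B ∧ ∀ U ∈ 𝒱, ¬ StronglyContains U B := by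
    by_contra! h'
    exact hcon.2 (mem_strongCovers_iff.2
      ⟨fun U hU => hopen U (Or.inr hU), fun hU => huniv (Or.inr hU), h'⟩)
  obtain ⟨U, hU | hU, hBC⟩ := hB (B ∪ C) (hB𝔅.union hC𝔅)
  · exact hBU U hU (hBC.mono subset_rfl Set.subset_union_left)
  · exact hCU U hU (hBC.mono subset_rfl Set.subset_union_right)

theorem not_mem_strongCovers_of_finite {𝒰 : Set (Set X)} (hfin : 𝒰.Finite) :
    𝒰 ∉ strongCovers 𝔅 := by
  intro h
  -- A set of the bornology that leaves every member of `𝒰` consists of one missed point for each.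
  have hx : ∀ U : 𝒰, ∃ x, x ∉ U.1 := fun U =>
    (Set.ne_univ_iff_exists_notMem U.1).1 fun hU => h.2.1 (hU ▸ U.2)
  choose x hx using hx
  have := hfin.to_subtype
  obtain ⟨U, hU, hB⟩ := (mem_strongCovers_iff.1 h).2.2 (Set.range x)
    (mem_of_finite (Set.finite_range x))
  exact hx ⟨U, hU⟩ (hB.subset (Set.mem_range_self _))

theorem diff_mem_strongCovers {𝒰 ℱ : Set (Set X)} (h : 𝒰 ∈ strongCovers 𝔅) (hℱ : ℱ.Finite) :
    𝒰 \ ℱ ∈ strongCovers 𝔅 := by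
  rw [← Set.sdiff_union_inter 𝒰 ℱ] at h
  exact (union_mem_strongCovers h).resolve_right
    (not_mem_strongCovers_of_finite (hℱ.subset Set.inter_subset_right))

theorem IsGroupable.countable {𝒰 : Set (Set X)} (h : IsGroupable 𝔅 𝒰) : 𝒰.Countable := by
  obtain ⟨𝒱, hfin, -, rfl, -⟩ := h
  exact Set.countable_iUnion fun m => (hfin m).countable

theorem IsGroupable.of_subset {𝒰 𝒲 : Set (Set X)} (h : IsGroupable 𝔅 𝒰) (h𝒰 : 𝒰 ⊆ 𝒲)
    (hc : 𝒲.Countable) : IsGroupable 𝔅 𝒲 := by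
  obtain ⟨𝒱, hfin, hdisj, rfl, hB⟩ := h
  obtain ⟨e, he⟩ := Set.countable_iff_exists_injOn.1 hc
  refine ⟨fun m => 𝒱 m ∪ {U ∈ 𝒲 \ ⋃ m, 𝒱 m | e U = m}, fun m => (hfin m).union ?_, ?_, ?_, ?_⟩
  · exact Set.Subsingleton.finite fun U hU V hV => he hU.1.1 hV.1.1 (hU.2.trans hV.2.symm)
  · intro l m hlm
    refine Set.disjoint_left.2 ?_
    rintro U (hU | hU) (hU' | hU')
    · exact Set.disjoint_left.1 (hdisj hlm) hU hU'
    · exact hU'.1.2 (Set.mem_iUnion_of_mem l hU)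
    · exact hU.1.2 (Set.mem_iUnion_of_mem m hU')
    · exact hlm (hU.2.symm.trans hU'.2)
  · ext U
    constructor
    · intro hU
      by_cases hU' : U ∈ ⋃ m, 𝒱 m
      · obtain ⟨m, hm⟩ := Set.mem_iUnion.1 hU'
        exact Set.mem_iUnion.2 ⟨m, Or.inl hm⟩
      · exact Set.mem_iUnion.2 ⟨e U, Or.inr ⟨⟨hU, hU'⟩, rfl⟩⟩
    · intro hU
      obtain ⟨m, hm | hm⟩ := Set.mem_iUnion.1 hU
      · exact h𝒰 (Set.mem_iUnion_of_mem m hm)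
      · exact hm.1.1
  · intro B hB𝔅
    obtain ⟨m₀, hm₀⟩ := hB B hB𝔅
    refine ⟨m₀, fun m hm => ?_⟩
    obtain ⟨U, hU, hUB⟩ := hm₀ m hm
    exact ⟨U, Or.inl hU, hUB⟩

/-! ### Selection makes the coideal selective -/

/-- The sets in the coideal are the index sets of strong covers. The selected family may have
repetitions, which is harmless: only indices selected before stage `i` can lie outside `A i`. -/
theorem exists_pseudoIntersection (hS : SelectionS1 (strongCovers 𝔅) (strongCovers 𝔅))
    {U : ℕ → Set X} {A : ℕ → Set ℕ} (hA : Antitone A)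
    (hAU : ∀ i, U '' A i ∈ strongCovers 𝔅) :
    ∃ D ⊆ A 0, U '' D ∈ strongCovers 𝔅 ∧ ∀ i, (D \ A i).Finite := by
  obtain ⟨b, hb, hbU⟩ := hS _ hAU
  choose d hdA hdb using hb
  obtain rfl : (fun m => U (d m)) = b := funext hdb
  refine ⟨Set.range d, ?_, by rwa [← Set.range_comp], fun i => ?_⟩
  · rintro _ ⟨m, rfl⟩
    exact hA (Nat.zero_le m) (hdA m)
  · refine ((Set.finite_lt_nat i).image d).subset ?_
    rintro _ ⟨⟨m, rfl⟩, hm⟩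
    exact ⟨m, not_le.1 fun him => hm (hA him (hdA m)), rfl⟩

theorem exists_finset_stronglyContains {U : ℕ → Set X} {h : ℕ → ℕ}
    (hh : ∀ k, (h ⁻¹' {k}).Finite) {D : Set ℕ} (hD : U '' D ∈ strongCovers 𝔅) (n : ℕ) {B : Set X}
    (hB : Mem 𝔅 B) : ∃ s : Finset ℕ, (s : Set ℕ) ⊆ D ∧ s.card = n ∧ Set.InjOn h s ∧
      ∀ i ∈ s, StronglyContains (U i) B := by
  induction n with
  | zero => exact ⟨∅, by simp⟩
  | succ n ih =>
    obtain ⟨s, hsD, hcard, hinj, hsB⟩ := ih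
    have hfin : (U '' ⋃ i ∈ s, h ⁻¹' {h i}).Finite :=
      (s.finite_toSet.biUnion fun i _ => hh (h i)).image U
    obtain ⟨_, ⟨⟨j, hjD, rfl⟩, hj⟩, hjB⟩ :=
      (mem_strongCovers_iff.1 (diff_mem_strongCovers hD hfin)).2.2 B hB
    have hjs : ∀ i ∈ s, h j ≠ h i := fun i hi hji =>
      hj ⟨j, Set.mem_biUnion hi hji, rfl⟩
    have hjns : j ∉ s := fun hjs' => hjs j hjs' rfl
    refine ⟨insert j s, ?_, by rw [Finset.card_insert_of_notMem hjns, hcard], ?_, ?_⟩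
    · rw [Finset.coe_insert]
      exact Set.insert_subset hjD hsD
    · rw [Finset.coe_insert, Set.injOn_insert (by simpa using hjns)]
      refine ⟨hinj, ?_⟩
      rintro ⟨i, hi, hij⟩
      exact hjs i hi hij.symm
    · intro i hi
      rcases Finset.mem_insert.1 hi with rfl | hi
      · exact hjB
      · exact hsB i hi

/-- The coideal is closed under selectors for finite-to-one maps. -/
theorem exists_injOn (hS : SelectionS1 (strongCovers 𝔅) (strongCovers 𝔅)) {U : ℕ → Set X}
    {h : ℕ → ℕ} (hh : ∀ k, (h ⁻¹' {k}).Finite) {D : Set ℕ} (hD : U '' D ∈ strongCovers 𝔅) :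
    ∃ E ⊆ D, U '' E ∈ strongCovers 𝔅 ∧ Set.InjOn h E := by
  obtain ⟨hopen, huniv, -⟩ := mem_strongCovers_iff.1 hD
  let 𝒱 : ℕ → Set (Set X) := fun n =>
    {V | ∃ s : Finset ℕ, (s : Set ℕ) ⊆ D ∧ s.card = n + 1 ∧ Set.InjOn h s ∧ V = ⋂ i ∈ s, U i}
  have h𝒱 : ∀ n, 𝒱 n ∈ strongCovers 𝔅 := by
    refine fun n => mem_strongCovers_iff.2 ⟨?_, ?_, fun B hB => ?_⟩
    · rintro _ ⟨s, hsD, -, -, rfl⟩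
      exact isOpen_biInter_finset fun i hi => hopen _ ⟨i, hsD hi, rfl⟩
    · rintro ⟨s, hsD, hcard, -, hs⟩
      obtain ⟨i, hi⟩ : s.Nonempty := Finset.card_pos.1 (by omega)
      have : U i = Set.univ := Set.univ_subset_iff.1 (hs ▸ Set.biInter_subset_of_mem hi)
      exact huniv ⟨i, hsD hi, this⟩
    · obtain ⟨s, hsD, hcard, hinj, hsB⟩ := exists_finset_stronglyContains hh hD (n + 1) hB
      exact ⟨_, ⟨s, hsD, hcard, hinj, rfl⟩, StronglyContains.biInter s hsB⟩
  obtain ⟨b, hb, hbU⟩ := hS 𝒱 h𝒱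
  choose s hsD hcard hinj hbs using hb
  -- The `n`-th selected intersection meets `n + 1` fibres, so distinct fibres can be assigned.
  obtain ⟨t, ht, hts⟩ := exists_injective_mem_of_lt_card (fun n => (s n).image h) fun n => by
    rw [Finset.card_image_of_injOn (hinj n), hcard]
    exact Nat.lt_succ_self n
  choose d hds hdt using fun n => Finset.mem_image.1 (hts n)
  have hdD : Set.range d ⊆ D := by
    rintro _ ⟨n, rfl⟩
    exact hsD n (hds n)
  refine ⟨Set.range d, hdD, strongCovers_of_refines hbU
    (fun V hV => hopen V (Set.image_mono hdD hV)) (fun hV => huniv (Set.image_mono hdD hV)) ?_, ?_⟩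
  · rintro _ ⟨n, rfl⟩
    refine ⟨U (d n), ⟨d n, ⟨n, rfl⟩, rfl⟩, ?_⟩
    rw [hbs n]
    exact Set.biInter_subset_of_mem (hds n)
  · rintro _ ⟨m, rfl⟩ _ ⟨n, rfl⟩ hmn
    rw [hdt, hdt] at hmn
    rw [ht hmn]

theorem exists_diagonal (hS : SelectionS1 (strongCovers 𝔅) (strongCovers 𝔅)) {U : ℕ → Set X}
    {A : ℕ → Set ℕ} (hA : Antitone A)
    (hAU : ∀ i, U '' A i ∈ strongCovers 𝔅) :
    ∃ D, U '' D ∈ strongCovers 𝔅 ∧ D ⊆ A 0 ∧ ∀ i ∈ D, ∀ j ∈ D, i < j → j ∈ A i := by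
  obtain ⟨E, hE0, hE, hfin⟩ := exists_pseudoIntersection hS hA hAU
  have hg : ∀ i, ∃ m, ∀ j ∈ E, m ≤ j → j ∈ A i := by
    intro i
    obtain ⟨m, hm⟩ := (hfin i).bddAbove
    refine ⟨m + 1, fun j hj hmj => ?_⟩
    by_contra hjA
    have : j ≤ m := hm ⟨hj, hjA⟩
    omega
  choose g hg using hg
  obtain ⟨h, hmono, hfib, hsep⟩ := exists_separating_map g
  obtain ⟨F, hFE, hF, hinj⟩ := exists_injOn hS hfib hE
  -- Values of `h` of the same parity that differ do so by at least two.
  have key : ∀ r, ∀ i ∈ {i ∈ F | h i % 2 = r}, ∀ j ∈ {i ∈ F | h i % 2 = r}, i < j → j ∈ A i := by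
    rintro r i ⟨hiF, hi⟩ j ⟨hjF, hj⟩ hij
    have h1 : h i ≤ h j := hmono hij.le
    have h2 : h i ≠ h j := fun hh => hij.ne (hinj hiF hjF hh)
    exact hg i j (hFE hjF) (hsep i j (by omega))
  have hsplit : F = {i ∈ F | h i % 2 = 0} ∪ {i ∈ F | h i % 2 = 1} := by
    ext i
    simp only [Set.mem_union, Set.mem_ofPred_eq, ← and_or_left, Nat.mod_two_eq_zero_or_one, and_true]
  rw [hsplit, Set.image_union] at hF
  rcases union_mem_strongCovers hF with hF | hF
  · exact ⟨_, hF, fun i hi => hE0 (hFE hi.1), key 0⟩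
  · exact ⟨_, hF, fun i hi => hE0 (hFE hi.1), key 1⟩

/-! ### The two implications -/

theorem partitionRel_of_gerlitsNagy (h : GerlitsNagy 𝔅) (n k : ℕ) (hk : 1 ≤ k) :
    PartitionRel (strongCovers 𝔅) (groupableCovers 𝔅) n k := by
  classical
  have hS : SelectionS1 (strongCovers 𝔅) (strongCovers 𝔅) := fun A hA =>
    (h A hA).imp fun _ hb => ⟨hb.1, hb.2.1⟩
  have hsub : ∀ 𝒰 ∈ strongCovers 𝔅, ∃ 𝒱 ∈ groupableCovers 𝔅, 𝒱 ⊆ 𝒰 := fun 𝒰 h𝒰 => by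
    obtain ⟨b, hb, hbg⟩ := h (fun _ => 𝒰) fun _ => h𝒰
    exact ⟨_, hbg, Set.range_subset_iff.2 hb⟩
  intro 𝒰 h𝒰 f
  obtain ⟨𝒱, ⟨h𝒱, h𝒱g⟩, h𝒱𝒰⟩ := hsub 𝒰 h𝒰
  have : Infinite 𝒱 := Set.infinite_coe_iff.2 fun hfin => not_mem_strongCovers_of_finite hfin h𝒱
  have : Countable 𝒱 := h𝒱g.countable.to_subtype
  obtain ⟨e⟩ := nonempty_equiv_of_countable (α := ℕ) (β := 𝒱)
  let U : ℕ → Set X := fun i => (e i).1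
  have hU : Function.Injective U := Subtype.val_injective.comp e.injective
  have hU𝒰 : ∀ i, U i ∈ 𝒰 := fun i => h𝒱𝒰 (e i).2
  have hUrange : U '' Set.univ = 𝒱 := by
    rw [Set.image_univ, show U = Subtype.val ∘ e from rfl, EquivLike.range_comp, Subtype.range_coe]
  have himage : ∀ s : Finset ℕ, s.card = n → s.image U ∈ nSubsets 𝒰 n := fun s hs =>
    ⟨by simpa [Set.subset_def] using fun i _ => hU𝒰 i, by
      rw [Finset.card_image_of_injective s hU, hs]⟩
  obtain ⟨D, -, hD, c, hc⟩ := exists_homogeneous (P := fun A => U '' A ∈ strongCovers 𝔅)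
    (by simpa using not_mem_strongCovers_of_finite Set.finite_empty)
    (fun A B hAB => union_mem_strongCovers (by rwa [← Set.image_union]))
    (fun A hA hAU => exists_diagonal hS hA hAU) n
    (fun s => if hs : s.card = n then f ⟨s.image U, himage s hs⟩ else ⟨0, hk⟩) Set.univ
    (by rwa [hUrange])
  obtain ⟨𝒲, h𝒲, h𝒲D⟩ := hsub _ hD
  have hD𝒰 : U '' D ⊆ 𝒰 := by
    rintro _ ⟨i, -, rfl⟩
    exact hU𝒰 i
  refine ⟨c, 𝒲, h𝒲, h𝒲D.trans hD𝒰, ?_⟩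
  rintro ⟨s, hs⟩ hs𝒲
  obtain ⟨t, htD, rfl⟩ := Finset.subset_set_image_iff.1 (hs𝒲.trans h𝒲D)
  have htn : t.card = n := by rw [← hs.2, Finset.card_image_of_injective t hU]
  simpa [htn] using hc t htD htn

theorem selectionS1_of_partitionRel
    (hcount : ∀ 𝒰 ∈ strongCovers 𝔅, ∃ 𝒱 ∈ strongCovers 𝔅, 𝒱 ⊆ 𝒰 ∧ 𝒱.Countable)
    (h : PartitionRel (strongCovers 𝔅) (strongCovers 𝔅) 2 2) :
    SelectionS1 (strongCovers 𝔅) (strongCovers 𝔅) := by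
  classical
  intro A hA
  obtain ⟨𝒱, h𝒱, -, h𝒱c⟩ := hcount (A 0) (hA 0)
  obtain ⟨V, rfl⟩ := h𝒱c.exists_eq_range (nonempty_of_mem_strongCovers h𝒱)
  obtain ⟨hVopen, hVuniv, hVB⟩ := mem_strongCovers_iff.1 h𝒱
  have hVne : ∀ n, V n ≠ Set.univ := fun n hn => hVuniv ⟨n, hn⟩
  let 𝒰 : Set (Set X) := {U | ∃ n, ∃ W ∈ A n, U = V n ∩ W}
  have h𝒰 : 𝒰 ∈ strongCovers 𝔅 := by
    refine mem_strongCovers_iff.2 ⟨?_, ?_, fun B hB => ?_⟩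
    · rintro _ ⟨n, W, hW, rfl⟩
      exact (hVopen _ ⟨n, rfl⟩).inter ((hA n).1.1 W hW)
    · rintro ⟨n, W, -, hn⟩
      exact hVne n (Set.univ_subset_iff.1 (hn ▸ Set.inter_subset_left))
    · obtain ⟨_, ⟨n, rfl⟩, hn⟩ := hVB B hB
      obtain ⟨W, hW, hWB⟩ := (mem_strongCovers_iff.1 (hA n)).2.2 B hB
      exact ⟨_, ⟨n, W, hW, rfl⟩, hn.inter hWB⟩
  -- A set may be of the form `V n ∩ W` for several `n`; one index is fixed for each set.
  have hform : ∀ U ∈ 𝒰, ∃ n, ∃ W ∈ A n, U = V n ∩ W := fun _ hU => hU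
  choose! ν w hw hνw using hform
  obtain ⟨c, 𝒯, h𝒯, h𝒯𝒰, hc⟩ := h 𝒰 h𝒰 fun s =>
    if ∀ U ∈ s.1, ∀ U' ∈ s.1, ν U = ν U' then 0 else 1
  have hpair : ∀ U ∈ 𝒯, ∀ U' ∈ 𝒯, U ≠ U' → (ν U = ν U' ↔ c = 0) := by
    intro U hU U' hU' hne
    have hsub : (({U, U'} : Finset (Set X)) : Set (Set X)) ⊆ 𝒯 := by
      rw [Finset.coe_pair]
      exact Set.pair_subset hU hU'
    rw [← hc ⟨{U, U'}, hsub.trans h𝒯𝒰, Finset.card_pair hne⟩ hsub]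
    simp +contextual [eq_comm]
  have hinj : Set.InjOn ν 𝒯 := by
    intro U hU U' hU' hν
    by_contra hne
    -- One pair with equal indices makes all indices equal, and then `𝒯` covers only `V (ν U)`.
    have hc0 := (hpair U hU U' hU' hne).1 hν
    refine hVne (ν U) (Set.univ_subset_iff.1 ?_)
    rw [← h𝒯.1.2]
    refine Set.sUnion_subset fun T hT => ?_
    have hνT : ν T = ν U := by
      by_cases hTU : T = U
      · rw [hTU]
      · exact (hpair T hT U hU hTU).2 hc0
    rw [hνw T (h𝒯𝒰 hT), hνT]
    exact Set.inter_subset_left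
  have hb : ∀ n, ∃ W ∈ A n, ∀ U ∈ 𝒯, ν U = n → U ⊆ W := by
    intro n
    by_cases hn : ∃ U ∈ 𝒯, ν U = n
    · obtain ⟨U, hU, rfl⟩ := hn
      refine ⟨w U, hw U (h𝒯𝒰 hU), fun U' hU' hν => ?_⟩
      rw [hinj hU' hU hν]
      conv_lhs => rw [hνw U (h𝒯𝒰 hU)]
      exact Set.inter_subset_right
    · obtain ⟨W, hW⟩ := nonempty_of_mem_strongCovers (hA n)
      exact ⟨W, hW, fun U hU hν => absurd ⟨U, hU, hν⟩ hn⟩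
  choose b hbA hbU using hb
  refine ⟨b, hbA, strongCovers_of_refines h𝒯 ?_ ?_ fun U hU =>
    ⟨b (ν U), ⟨_, rfl⟩, hbU _ U hU rfl⟩⟩
  · rintro _ ⟨n, rfl⟩
    exact (hA n).1.1 _ (hbA n)
  · rintro ⟨n, hn⟩
    exact (hA n).2.1 (hn ▸ hbA n)

theorem gerlitsNagy_of_partitionRel
    (h : ∀ n k : ℕ, 1 ≤ n → 1 ≤ k → PartitionRel (strongCovers 𝔅) (groupableCovers 𝔅) n k) :
    GerlitsNagy 𝔅 := by
  have hsub : ∀ 𝒰 ∈ strongCovers 𝔅, ∃ 𝒱 ∈ groupableCovers 𝔅, 𝒱 ⊆ 𝒰 := fun 𝒰 h𝒰 => by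
    obtain ⟨-, 𝒱, h𝒱, h𝒱𝒰, -⟩ := h 1 1 le_rfl le_rfl 𝒰 h𝒰 fun _ => 0
    exact ⟨𝒱, h𝒱, h𝒱𝒰⟩
  have hS : SelectionS1 (strongCovers 𝔅) (strongCovers 𝔅) := by
    refine selectionS1_of_partitionRel (fun 𝒰 h𝒰 => ?_) fun 𝒰 h𝒰 f => ?_
    · obtain ⟨𝒱, h𝒱, h𝒱𝒰⟩ := hsub 𝒰 h𝒰
      exact ⟨𝒱, h𝒱.1, h𝒱𝒰, h𝒱.2.countable⟩
    · obtain ⟨i, 𝒯, h𝒯, h𝒯'⟩ := h 2 2 one_le_two one_le_two 𝒰 h𝒰 f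
      exact ⟨i, 𝒯, h𝒯.1, h𝒯'⟩
  intro A hA
  obtain ⟨b, hbA, hb⟩ := hS A hA
  obtain ⟨𝒱, h𝒱, h𝒱b⟩ := hsub _ hb
  exact ⟨b, hbA, hb, h𝒱.2.of_subset h𝒱b (Set.countable_range b)⟩

end Bornological

theorem mainTheorem6 {X : Type*} [MetricSpace X] (𝔅 : Bornology X)
    (h𝔅 : Bornological.HasClosedBase 𝔅) :
    Bornological.GerlitsNagy 𝔅 ↔
      ∀ n k : ℕ, 1 ≤ n → 1 ≤ k →
        PartitionRel (Bornological.strongCovers 𝔅) (Bornological.groupableCovers 𝔅) n k :=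
  ⟨fun h n k _ hk => Bornological.partitionRel_of_gerlitsNagy h n k hk,
    Bornological.gerlitsNagy_of_partitionRel⟩
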